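/- Let $G=(V,E)$ be a finite directed graph with $n$ nodes whose edges $e$ carry propagation probabilities $p(e)\in(0,1]$, and let $\eta\in\{1,\dots,n\}$. A realization $\phi$ is obtained by declaring each edge $e$ live with probability $p(e)$ and blocked otherwise, independently (independent cascade model); $p(\phi)$ is its probability and $\Omega$ is the set of all $2^{|E|}$ realizations. For $S\subseteq V$ let $I_\phi(S)$ be the number of nodes reachable from $S$ along edges live in $\phi$ (the active nodes), and let $\Gamma_\phi(S)=\min\{I_\phi(S),\eta\}$. An adaptive policy $\pi$ selects seed nodes one by one; after each selection it observes which nodes have become active, and the decision to stop or which node to select next may depend on all observations so far. Let $S(\pi,\phi)$ be the seed set that $\pi$ selects under $\phi$. The policy is feasible if $I_\phi(S(\pi,\phi))\ge\eta$ for all $\phi\in\Omega$, and its cost is $\mathbb{E}[|S(\pi,\phi)|]=\sum_{\phi\in\Omega}|S(\pi,\phi)|\,p(\phi)$. If $S_{i-1}$ is the set of the first $i-1$ selected seeds, $V_i$ is the set of nodes that are still inactive at the beginning of round $i$, and $v\in V_i$, the expected marginal truncated spread $\Delta(v\mid S_{i-1})$ is the conditional expectation of $\Gamma_\Phi(S_{i-1}\cup\{v\})-\Gamma_\Phi(S_{i-1})$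 over the random realization $\Phi$, given the observations made in rounds $1,\dots,i-1$. Let $\alpha\in(0,1]$ and let $\pi$ be an $\alpha$-approximate greedy policy: as long as fewer than $\eta$ nodes are active, in each round $i$ it selects some $s_i\in V_i$ with $$\Delta(s_i\mid S_{i-1})\ \ge\ \alpha\,\Delta(v\mid S_{i-1})\quad\text{for all } v\in V_i ,$$ and it stops as soon as at least $\eta$ nodes are active. Then $\pi$ is feasible, and for every feasible adaptive policy $\pi^*$, in particular for an optimal one, $$\mathbb{E}\big[|S(\pi,\phi)|\big]\ \le\ \frac{(\ln\eta+1)^2}{\alpha}\;\mathbb{E}\big[|S(\pi^*,\phi)|\big].$$ -/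

import Mathlib

namespace ASM

open Finset

/-- A probabilistic social network on the finite node set `V`: a set of directed edges, each
carrying a propagation probability in `(0, 1]`. -/
structure Network (V : Type*) where
  edges : Finset (V × V)
  prob : V × V → ℝ
  prob_pos : ∀ e ∈ edges, 0 < prob e
  prob_le_one : ∀ e ∈ edges, prob e ≤ 1

/-- A realization is recorded by its set of live edges. -/
abbrev Realization (V : Type*) := Finset (V × V)

section Spread

variable {V : Type*} [Fintype V]

open Classical in
/-- The nodes activated by the seed set `S` under the realization `φ`: those reachable from `S`
along live edges. -/
noncomputable def activated (φ : Realization V) (S : Finset V) : Finset V :=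
  {v | ∃ s ∈ S, Relation.ReflTransGen (fun a b => (a, b) ∈ φ) s v}

/-- The spread `I_φ(S)`. -/
noncomputable def spread (φ : Realization V) (S : Finset V) : ℕ := #(activated φ S)

/-- The truncated spread `Γ_φ(S) = min {I_φ(S), η}`. -/
noncomputable def truncSpread (η : ℕ) (φ : Realization V) (S : Finset V) : ℕ :=
  min (spread φ S) η

end Spread

section Policies

variable {V : Type*} [DecidableEq V]

/-- The sample space `Ω` of all `2 ^ m` realizations. -/
def Network.realizations (G : Network V) : Finset (Realization V) := G.edges.powerset

/-- The probability `p(φ)` of a realization: the edges are independent, and `e` is live with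
probability `p(e)`. -/
def Network.weight (G : Network V) (φ : Realization V) : ℝ :=
  ∏ e ∈ G.edges, if e ∈ φ then G.prob e else 1 - G.prob e

/-- An adaptive policy, as a finite decision tree: either stop, or select a node `v` as the next
seed, observe the set of nodes that are active once the propagation from `v` has ended, and
continue with a policy that may depend on this observation. -/
inductive Policy (V : Type*) where
  | done : Policy V
  | select (v : V) (next : Finset V → Policy V) : Policy V

variable [Fintype V]

/-- The seed set with which `π` ends under `φ` when the seeds in `S` were selected before. -/
noncomputable def Policy.seedsFrom (φ : Realization V) : Policy V → Finset V → Finset V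
  | .done, S => S
  | .select v next, S => (next (activated φ (insert v S))).seedsFrom φ (insert v S)

/-- The seed set `S(π, φ)` selected by `π` under the realization `φ`. -/
noncomputable def Policy.seeds (π : Policy V) (φ : Realization V) : Finset V :=
  π.seedsFrom φ ∅

/-- The expected number of seeds `E[|S(π, φ)|]`. -/
noncomputable def expectedCost (G : Network V) (π : Policy V) : ℝ :=
  ∑ φ ∈ G.realizations, G.weight φ * (#(π.seeds φ) : ℝ)

/-- Feasibility in adaptive seed minimization: `π` activates at least `η` nodes under every
realization. -/
def IsFeasible (G : Network V) (η : ℕ) (π : Policy V) : Prop :=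
  ∀ φ ∈ G.realizations, η ≤ spread φ (π.seeds φ)

/-- What is known at the beginning of a round: the seeds selected so far, the nodes that have been
observed to be active, and the realizations that are consistent with all observations made in the
previous rounds. -/
structure Knowledge (V : Type*) where
  seeds : Finset V
  active : Finset V
  consistent : Finset (Realization V)

/-- At the beginning of the first round nothing has been observed. -/
def Knowledge.initial (G : Network V) : Knowledge V where
  seeds := ∅
  active := ∅
  consistent := G.realizations

open Classical in
/-- The knowledge after selecting `v` and observing that `A` is now the set of active nodes. -/
noncomputable def Knowledge.update (K : Knowledge V) (v : V) (A : Finset V) : Knowledge V where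
  seeds := insert v K.seeds
  active := A
  consistent := {φ ∈ K.consistent | activated φ (insert v K.seeds) = A}

/-- The expected marginal truncated spread `Δ(v ∣ S)` of `v` on top of the selected seeds `S`:
the expectation of `Γ_Φ(S ∪ {v}) - Γ_Φ(S)`, where `Φ` is distributed according to `p` conditioned on
being consistent with the observations. (If these have probability `0`, the value is `0`.) -/
noncomputable def marginal (G : Network V) (η : ℕ) (K : Knowledge V) (v : V) : ℝ :=
  (∑ φ ∈ K.consistent, G.weight φ *
      ((truncSpread η φ (insert v K.seeds) : ℝ) - (truncSpread η φ K.seeds : ℝ))) /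
    ∑ φ ∈ K.consistent, G.weight φ

/-- The policy proceeds as an `α`-approximate greedy policy from the knowledge `K` on. If at least
`η` nodes are active it stops. Otherwise it selects a node of the residual graph, i.e. an inactive
one, whose expected marginal truncated spread is at least `α` times that of every node of the
residual graph; and it proceeds in this way after every observation that can occur. -/
def IsApproxGreedyFrom (G : Network V) (η : ℕ) (α : ℝ) : Policy V → Knowledge V → Prop
  | .done, K => η ≤ #K.active
  | .select s next, K =>
      #K.active < η ∧ s ∉ K.active ∧
      (∀ v, v ∉ K.active → α * marginal G η K v ≤ marginal G η K s) ∧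
      ∀ A : Finset V, (K.update s A).consistent.Nonempty →
        IsApproxGreedyFrom G η α (next A) (K.update s A)

/-- `α`-approximate greedy policies for adaptive seed minimization with threshold `η`. -/
def IsApproxGreedy (G : Network V) (η : ℕ) (α : ℝ) (π : Policy V) : Prop :=
  IsApproxGreedyFrom G η α π (Knowledge.initial G)

end Policies

end ASM

/-! By independence, conditioning on the observations leaves the edges out of inactive nodes with
their original law, so `marginal` equals `residualGain` at the active set. `residualGain` only falls
as that set grows. Let M be the largest residual gain at some knowledge. Running any feasible policy
from scratch on top of the current seeds gains at most M per seed in expectation, so the expected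
shortfall to `η` is at most M times that policy's cost (`sum_shortfall_le_of_isFeasible`). A greedy
step gains at least αM, so it costs at most 1/(αM) per unit of spread. The price 1/M rises along the
run. Integrating shortfall ≤ cost / price over the price t from 1/η to 1 gives α·cost(π) ≤ 1 + ln η
· cost(π*) (`IsApproxGreedyFrom.sum_cost_le`), which is stronger than the claim because cost(π*) ≥
1. -/

namespace ASM

open Finset

/-! ### Reachability and increments of the truncated spread. -/

section Reachability

variable {V : Type*} [Fintype V]

lemma mem_activated {φ : Realization V} {S : Finset V} {v : V} :
    v ∈ activated φ S ↔ ∃ s ∈ S, Relation.ReflTransGen (fun a b => (a, b) ∈ φ) s v := by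
  simp [activated]

lemma subset_activated (φ : Realization V) (S : Finset V) : S ⊆ activated φ S :=
  fun s hs => mem_activated.2 ⟨s, hs, .refl⟩

lemma activated_closed {φ : Realization V} {S : Finset V} {a b : V}
    (ha : a ∈ activated φ S) (hab : (a, b) ∈ φ) : b ∈ activated φ S := by
  obtain ⟨s, hs, h⟩ := mem_activated.1 ha
  exact mem_activated.2 ⟨s, hs, h.tail hab⟩

lemma activated_subset_of_closed {φ : Realization V} {S B : Finset V} (hS : S ⊆ B)
    (hB : ∀ a ∈ B, ∀ b, (a, b) ∈ φ → b ∈ B) : activated φ S ⊆ B := by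
  intro v hv
  obtain ⟨s, hs, h⟩ := mem_activated.1 hv
  induction h with
  | refl => exact hS hs
  | tail h1 h2 ih => exact hB _ (ih (mem_activated.2 ⟨s, hs, h1⟩)) _ h2

lemma activated_mono {φ ψ : Realization V} {S T : Finset V} (hφ : φ ⊆ ψ) (hS : S ⊆ T) :
    activated φ S ⊆ activated ψ T :=
  activated_subset_of_closed (hS.trans (subset_activated ψ T))
    fun _ ha _ hab => activated_closed ha (hφ hab)

lemma activated_empty (φ : Realization V) : activated φ ∅ = ∅ :=
  subset_empty.1 (activated_subset_of_closed (Subset.refl _) (by simp))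

lemma activated_union [DecidableEq V] (φ : Realization V) (S T : Finset V) :
    activated φ (S ∪ T) = activated φ S ∪ activated φ T := by
  ext v
  simp only [mem_union, mem_activated, or_and_right, exists_or]

/-- Every live path from `S` stays inside `A`, so only edges leaving `A` can affect the outcome. -/
lemma activated_congr {φ ψ : Realization V} {S A : Finset V} (hφ : activated φ S = A)
    (h : ∀ e, e.1 ∈ A → (e ∈ φ ↔ e ∈ ψ)) : activated ψ S = A := by
  subst hφ
  refine Subset.antisymm (activated_subset_of_closed (subset_activated φ S)
    fun a ha b hab => activated_closed ha ((h (a, b) ha).2 hab)) ?_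
  intro v hv
  obtain ⟨s, hs, hr⟩ := mem_activated.1 hv
  induction hr with
  | refl => exact subset_activated ψ S hs
  | tail h1 h2 ih =>
    have ha := mem_activated.2 ⟨s, hs, h1⟩
    exact activated_closed (ih ha) ((h (_, _) ha).1 h2)

lemma truncSpread_eq_of_le {η : ℕ} {φ : Realization V} {S T : Finset V} (hS : η ≤ spread φ S)
    (h : S ⊆ T) : truncSpread η φ T = η :=
  min_eq_right (hS.trans (card_le_card (activated_mono (Subset.refl _) h)))

variable [DecidableEq V]

/-- The nodes outside `B` that `v` activates without using the edges leaving nodes of `B`. -/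
noncomputable def newlyActivated (B : Finset V) (φ : Realization V) (v : V) : Finset V :=
  activated {e ∈ φ | e.1 ∉ B} {v} \ B

/-- The truncated spread that `v` adds when exactly the nodes in `B` are active. -/
noncomputable def residualIncrement (η : ℕ) (B : Finset V) (φ : Realization V) (v : V) : ℝ :=
  ((min (#B + #(newlyActivated B φ v)) η : ℕ) : ℝ) - ((min #B η : ℕ) : ℝ)

lemma activated_insert {φ : Realization V} {S B : Finset V} (h : activated φ S = B) (v : V) :
    activated φ (insert v S) = B ∪ newlyActivated B φ v := by
  rw [newlyActivated, union_sdiff_self_eq_union]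
  apply Subset.antisymm
  · refine activated_subset_of_closed ?_ ?_
    · refine insert_subset (mem_union_right _ (subset_activated _ _ (mem_singleton_self v))) ?_
      exact (h ▸ subset_activated φ S).trans subset_union_left
    · intro a ha b hab
      by_cases haB : a ∈ B
      · exact mem_union_left _ (h ▸ activated_closed (h.symm ▸ haB) hab)
      · refine mem_union_right _ (activated_closed ((mem_union.1 ha).resolve_left haB) ?_)
        exact mem_filter.2 ⟨hab, haB⟩
  · refine union_subset (h ▸ activated_mono (Subset.refl _) (subset_insert v S)) ?_
    exact activated_mono (filter_subset _ _) (by simp)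

lemma truncSpread_insert_sub (η : ℕ) {φ : Realization V} {S B : Finset V}
    (h : activated φ S = B) (v : V) :
    (truncSpread η φ (insert v S) : ℝ) - (truncSpread η φ S : ℝ) = residualIncrement η B φ v := by
  have hd : Disjoint B (newlyActivated B φ v) := disjoint_sdiff
  rw [truncSpread, truncSpread, spread, spread, activated_insert h, h, card_union_of_disjoint hd]
  rfl

lemma newlyActivated_anti {A B : Finset V} (h : A ⊆ B) (φ : Realization V) (v : V) :
    newlyActivated B φ v ⊆ newlyActivated A φ v :=
  sdiff_subset_sdiff
    (activated_mono (monotone_filter_right _ fun _ _ he h' => he (h h')) (Subset.refl _)) h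

/-- Fewer nodes are newly activated over a larger set, and truncation at `η` is concave. -/
lemma residualIncrement_anti (η : ℕ) {A B : Finset V} (h : A ⊆ B) (φ : Realization V) (v : V) :
    residualIncrement η B φ v ≤ residualIncrement η A φ v := by
  have h1 := card_le_card (newlyActivated_anti h φ v)
  have h2 := card_le_card h
  rw [residualIncrement, residualIncrement, sub_le_sub_iff]
  norm_cast
  omega

lemma residualIncrement_of_mem (η : ℕ) {B : Finset V} (φ : Realization V) {v : V} (hv : v ∈ B) :
    residualIncrement η B φ v = 0 := by
  have : newlyActivated B φ v = ∅ := by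
    refine sdiff_eq_empty_iff_subset.2 ((activated_subset_of_closed (Subset.refl {v}) ?_).trans
      (by simpa using hv))
    intro a ha b hab
    rw [mem_singleton.1 ha] at hab
    exact absurd hv (mem_filter.1 hab).2
  simp [residualIncrement, this]

lemma one_le_residualIncrement {η : ℕ} {B : Finset V} (hB : #B < η) (φ : Realization V) {v : V}
    (hv : v ∉ B) : 1 ≤ residualIncrement η B φ v := by
  have : 0 < #(newlyActivated B φ v) :=
    card_pos.2 ⟨v, mem_sdiff.2 ⟨subset_activated _ _ (mem_singleton_self v), hv⟩⟩
  rw [residualIncrement, le_sub_iff_add_le]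
  norm_cast
  omega

lemma residualIncrement_le (η : ℕ) (B : Finset V) (φ : Realization V) (v : V) :
    residualIncrement η B φ v ≤ η := by
  rw [residualIncrement, sub_le_iff_le_add]
  norm_cast
  omega

lemma residualIncrement_congr (η : ℕ) {B : Finset V} {φ ψ : Realization V}
    (h : ∀ e, e.1 ∉ B → (e ∈ φ ↔ e ∈ ψ)) (v : V) :
    residualIncrement η B φ v = residualIncrement η B ψ v := by
  have : {e ∈ φ | e.1 ∉ B} = {e ∈ ψ | e.1 ∉ B} := by
    ext e
    simp only [mem_filter]
    exact ⟨fun ⟨h1, h2⟩ => ⟨(h e h2).1 h1, h2⟩, fun ⟨h1, h2⟩ => ⟨(h e h2).2 h1, h2⟩⟩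
  rw [residualIncrement, residualIncrement, newlyActivated, newlyActivated, this]

end Reachability

/-! ### Independence of the edges inside and outside the observed region. -/

section Independence

variable {V : Type*} [DecidableEq V]

lemma Network.weight_nonneg (G : Network V) (φ : Realization V) : 0 ≤ G.weight φ := by
  refine prod_nonneg fun e he => ?_
  split_ifs
  · exact (G.prob_pos e he).le
  · exact sub_nonneg.2 (G.prob_le_one e he)

lemma Network.sum_weight (G : Network V) : ∑ φ ∈ G.realizations, G.weight φ = 1 := by
  have h := prod_add (fun e => G.prob e) (fun e => 1 - G.prob e) G.edges
  simp only [add_sub_cancel, prod_const_one] at h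
  rw [h]
  refine sum_congr rfl fun φ hφ => ?_
  rw [Network.weight, prod_ite]
  have hφ' : φ ⊆ G.edges := mem_powerset.1 hφ
  congr 1
  · rw [filter_mem_eq_inter, inter_eq_right.2 hφ']
  · rw [filter_notMem_eq_sdiff]

lemma Network.sum_weight_mul_sub_eq_add (G : Network V) (C : Finset (Realization V))
    (a b c : Realization V → ℝ) :
    ∑ φ ∈ C, G.weight φ * (a φ - c φ) =
      ∑ φ ∈ C, G.weight φ * (b φ - c φ) + ∑ φ ∈ C, G.weight φ * (a φ - b φ) := by
  rw [← sum_add_distrib]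
  exact sum_congr rfl fun φ _ => by ring

/-- The realization that follows `φ` on the edges leaving nodes of `B` and `ψ` on all others. -/
def splice (B : Finset V) (φ ψ : Realization V) : Realization V :=
  {e ∈ φ | e.1 ∈ B} ∪ {e ∈ ψ | e.1 ∉ B}

lemma mem_splice {B : Finset V} {φ ψ : Realization V} {e : V × V} :
    e ∈ splice B φ ψ ↔ if e.1 ∈ B then e ∈ φ else e ∈ ψ := by
  by_cases h : e.1 ∈ B <;> simp [splice, h]

lemma splice_splice (B : Finset V) (φ ψ : Realization V) :
    splice B (splice B φ ψ) (splice B ψ φ) = φ := by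
  ext e
  by_cases h : e.1 ∈ B <;> simp [mem_splice, h]

lemma splice_mem_realizations {G : Network V} (B : Finset V) {φ ψ : Realization V}
    (hφ : φ ∈ G.realizations) (hψ : ψ ∈ G.realizations) : splice B φ ψ ∈ G.realizations :=
  mem_powerset.2 (union_subset ((filter_subset _ _).trans (mem_powerset.1 hφ))
    ((filter_subset _ _).trans (mem_powerset.1 hψ)))

lemma Network.weight_splice_mul (G : Network V) (B : Finset V) (φ ψ : Realization V) :
    G.weight (splice B φ ψ) * G.weight (splice B ψ φ) = G.weight φ * G.weight ψ := by
  simp only [Network.weight, ← prod_mul_distrib]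
  refine prod_congr rfl fun e _ => ?_
  by_cases h : e.1 ∈ B
  · simp [mem_splice, h]
  · simp [mem_splice, h, mul_comm]

/-- The event `C` depends only on the states of the edges leaving nodes of `B`. -/
structure IsDeterminedBy (G : Network V) (C : Finset (Realization V)) (B : Finset V) : Prop where
  subset : C ⊆ G.realizations
  mem_of_agree : ∀ φ ∈ C, ∀ ψ ∈ G.realizations, (∀ e, e.1 ∈ B → (e ∈ φ ↔ e ∈ ψ)) → ψ ∈ C

/-- An event on the edges leaving `B` is independent of a function of the other edges. Swapping the
two halves of a pair of realizations is an involution that preserves the product weight. -/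
lemma IsDeterminedBy.sum_weight_mul {G : Network V} {C : Finset (Realization V)} {B : Finset V}
    (hC : IsDeterminedBy G C B) (g : Realization V → ℝ)
    (hg : ∀ φ ψ : Realization V, (∀ e, e.1 ∉ B → (e ∈ φ ↔ e ∈ ψ)) → g φ = g ψ) :
    ∑ φ ∈ C, G.weight φ * g φ =
      (∑ φ ∈ C, G.weight φ) * ∑ φ ∈ G.realizations, G.weight φ * g φ := by
  have hmem : ∀ p ∈ C ×ˢ G.realizations,
      (splice B p.1 p.2, splice B p.2 p.1) ∈ C ×ˢ G.realizations := by
    intro p hp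
    obtain ⟨h1, h2⟩ := mem_product.1 hp
    refine mem_product.2 ⟨hC.mem_of_agree _ h1 _ (splice_mem_realizations B (hC.subset h1) h2) ?_,
      splice_mem_realizations B h2 (hC.subset h1)⟩
    intro e he
    simp [mem_splice, he]
  calc ∑ φ ∈ C, G.weight φ * g φ
      = (∑ φ ∈ C, G.weight φ * g φ) * ∑ ψ ∈ G.realizations, G.weight ψ := by
        rw [G.sum_weight, mul_one]
    _ = ∑ p ∈ C ×ˢ G.realizations, G.weight p.1 * g p.1 * G.weight p.2 := by
        rw [sum_mul_sum, sum_product]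
    _ = ∑ p ∈ C ×ˢ G.realizations, G.weight p.1 * (G.weight p.2 * g p.2) := by
        refine sum_nbij' (fun p => (splice B p.1 p.2, splice B p.2 p.1))
          (fun p => (splice B p.1 p.2, splice B p.2 p.1)) hmem hmem ?_ ?_ ?_
        · rintro ⟨φ, ψ⟩ _
          simp [splice_splice]
        · rintro ⟨φ, ψ⟩ _
          simp [splice_splice]
        · rintro ⟨φ, ψ⟩ _
          have hgφ : g φ = g (splice B ψ φ) := hg _ _ fun e he => by simp [mem_splice, he]
          have hw := G.weight_splice_mul B φ ψ
          simp only [hgφ]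
          linear_combination -g (splice B ψ φ) * hw
    _ = (∑ φ ∈ C, G.weight φ) * ∑ φ ∈ G.realizations, G.weight φ * g φ := by
        rw [sum_mul_sum, sum_product]

end Independence

/-! ### Residual gains and the lower bound on the cost of any feasible policy. -/

section ResidualGain

variable {V : Type*} [DecidableEq V] [Fintype V]

/-- The expected truncated spread that `v` adds when exactly the nodes in `B` are active. -/
noncomputable def residualGain (G : Network V) (η : ℕ) (B : Finset V) (v : V) : ℝ :=
  ∑ φ ∈ G.realizations, G.weight φ * residualIncrement η B φ v

lemma residualGain_anti (G : Network V) (η : ℕ) {A B : Finset V} (h : A ⊆ B) (v : V) :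
    residualGain G η B v ≤ residualGain G η A v :=
  sum_le_sum fun φ _ =>
    mul_le_mul_of_nonneg_left (residualIncrement_anti η h φ v) (G.weight_nonneg φ)

lemma residualGain_of_mem (G : Network V) (η : ℕ) {B : Finset V} {v : V} (hv : v ∈ B) :
    residualGain G η B v = 0 :=
  sum_eq_zero fun φ _ => by rw [residualIncrement_of_mem η φ hv, mul_zero]

lemma one_le_residualGain (G : Network V) {η : ℕ} {B : Finset V} (hB : #B < η) {v : V}
    (hv : v ∉ B) : 1 ≤ residualGain G η B v := by
  rw [← G.sum_weight]
  exact sum_le_sum fun φ _ =>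
    le_mul_of_one_le_right (G.weight_nonneg φ) (one_le_residualIncrement hB φ hv)

lemma residualGain_le (G : Network V) (η : ℕ) (B : Finset V) (v : V) :
    residualGain G η B v ≤ η := by
  calc residualGain G η B v ≤ ∑ φ ∈ G.realizations, G.weight φ * (η : ℝ) :=
        sum_le_sum fun φ _ =>
          mul_le_mul_of_nonneg_left (residualIncrement_le η B φ v) (G.weight_nonneg φ)
    _ = η := by rw [← sum_mul, G.sum_weight, one_mul]

/-- Conditioned on an event that depends only on the edges leaving active nodes, the expected
increment of the truncated spread is the residual gain. -/
lemma IsDeterminedBy.sum_truncSpread_insert {G : Network V} {η : ℕ} {C : Finset (Realization V)}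
    {S B : Finset V} (hC : IsDeterminedBy G C B) (hB : ∀ φ ∈ C, activated φ S = B) (v : V) :
    ∑ φ ∈ C, G.weight φ * ((truncSpread η φ (insert v S) : ℝ) - (truncSpread η φ S : ℝ)) =
      (∑ φ ∈ C, G.weight φ) * residualGain G η B v := by
  rw [residualGain, ← hC.sum_weight_mul _ fun φ ψ h => residualIncrement_congr η h v]
  exact sum_congr rfl fun φ hφ => by rw [truncSpread_insert_sub η (hB φ hφ)]

lemma IsDeterminedBy.filter_activated {G : Network V} {C : Finset (Realization V)}
    {S A B D : Finset V} (hC : IsDeterminedBy G C B) (hBD : B ⊆ D) (hAD : A ⊆ D) :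
    IsDeterminedBy G {φ ∈ C | activated φ S = A} D where
  subset := (filter_subset _ _).trans hC.subset
  mem_of_agree φ hφ ψ hψ h := by
    obtain ⟨h1, h2⟩ := mem_filter.1 hφ
    exact mem_filter.2 ⟨hC.mem_of_agree φ h1 ψ hψ fun e he => h e (hBD he),
      activated_congr h2 fun e he => h e (hAD he)⟩

/-- Every policy that is run on top of the seeds `S` gains at most `M` per additional seed in
expectation, where `M` bounds the residual gains for the set `A` activated by `S`. -/
lemma sum_gain_seedsFrom_le {G : Network V} {η : ℕ} {S A : Finset V} {M : ℝ}
    (hM : ∀ v, residualGain G η A v ≤ M) (π : Policy V) :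
    -- The policy observes only `D`, as if `S` were absent. The event must nevertheless fix the
    -- edges leaving all of `A ∪ D`, so that the gain on top of `S ∪ T` is a residual gain.
    ∀ (C : Finset (Realization V)) (T D : Finset V), IsDeterminedBy G C (A ∪ D) →
      (∀ φ ∈ C, activated φ S = A) → (∀ φ ∈ C, activated φ T = D) →
      ∑ φ ∈ C, G.weight φ * ((truncSpread η φ (S ∪ π.seedsFrom φ T) : ℝ) -
          (truncSpread η φ (S ∪ T) : ℝ)) ≤
        M * ∑ φ ∈ C, G.weight φ * ((#(π.seedsFrom φ T) : ℝ) - (#T : ℝ)) := by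
  induction π with
  | done => intro C T D _ _ _; simp [Policy.seedsFrom]
  | select v next ih =>
    intro C T D hC hS hT
    have hU : ∀ φ ∈ C, activated φ (S ∪ T) = A ∪ D := fun φ hφ => by
      rw [activated_union, hS φ hφ, hT φ hφ]
    have step : ∑ φ ∈ C, G.weight φ * ((truncSpread η φ (S ∪ insert v T) : ℝ) -
          (truncSpread η φ (S ∪ T) : ℝ)) ≤
        M * ∑ φ ∈ C, G.weight φ * ((#(insert v T) : ℝ) - (#T : ℝ)) := by
      -- A repeated seed costs nothing and gains nothing.
      by_cases hv : v ∈ T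
      · simp [insert_eq_of_mem hv]
      · rw [union_insert, hC.sum_truncSpread_insert hU, card_insert_of_notMem hv]
        simp only [Nat.cast_add, Nat.cast_one, add_sub_cancel_left, mul_one]
        rw [mul_comm M]
        exact mul_le_mul_of_nonneg_left
          ((residualGain_anti G η subset_union_left v).trans (hM v))
          (sum_nonneg fun φ _ => G.weight_nonneg φ)
    have rest : ∑ φ ∈ C, G.weight φ *
          ((truncSpread η φ (S ∪ (Policy.select v next).seedsFrom φ T) : ℝ) -
            (truncSpread η φ (S ∪ insert v T) : ℝ)) ≤
        M * ∑ φ ∈ C, G.weight φ *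
          ((#((Policy.select v next).seedsFrom φ T) : ℝ) - (#(insert v T) : ℝ)) := by
      rw [← sum_fiberwise C (fun φ => activated φ (insert v T)),
        ← sum_fiberwise C (fun φ => activated φ (insert v T)), mul_sum]
      refine sum_le_sum fun D' _ => ?_
      rcases ({φ ∈ C | activated φ (insert v T) = D'}).eq_empty_or_nonempty with h0 | ⟨φ₀, hφ₀⟩
      · simp [h0]
      · have hDD : D ⊆ D' := by
          obtain ⟨h1, h2⟩ := mem_filter.1 hφ₀
          rw [← hT φ₀ h1, ← h2]
          exact activated_mono (Subset.refl _) (subset_insert v T)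
        have key := ih D' {φ ∈ C | activated φ (insert v T) = D'} (insert v T) D'
          (hC.filter_activated (union_subset_union_right hDD) subset_union_right)
          (fun φ hφ => hS φ (mem_filter.1 hφ).1) (fun φ hφ => (mem_filter.1 hφ).2)
        have e : ∀ φ ∈ ({φ ∈ C | activated φ (insert v T) = D'} : Finset (Realization V)),
            (Policy.select v next).seedsFrom φ T = (next D').seedsFrom φ (insert v T) :=
          fun φ hφ => by rw [Policy.seedsFrom, (mem_filter.1 hφ).2]
        refine (le_of_eq ?_).trans (key.trans (le_of_eq ?_))
        · exact sum_congr rfl fun φ hφ => by rw [e φ hφ]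
        · exact congrArg (M * ·) (sum_congr rfl fun φ hφ => by rw [e φ hφ])
    rw [G.sum_weight_mul_sub_eq_add C _ (fun φ => (truncSpread η φ (S ∪ insert v T) : ℝ)),
      G.sum_weight_mul_sub_eq_add C
        (fun φ => (#((Policy.select v next).seedsFrom φ T) : ℝ)) (fun _ => (#(insert v T) : ℝ)),
      mul_add]
    exact add_le_add step rest

lemma sum_shortfall_le_of_isFeasible {G : Network V} {η : ℕ} {C : Finset (Realization V)}
    {S A : Finset V} {M : ℝ} (hM : ∀ v, residualGain G η A v ≤ M)
    (hC : IsDeterminedBy G C A) (hS : ∀ φ ∈ C, activated φ S = A) {π : Policy V}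
    (hπ : IsFeasible G η π) :
    ∑ φ ∈ C, G.weight φ * ((η : ℝ) - (truncSpread η φ S : ℝ)) ≤
      M * ∑ φ ∈ C, G.weight φ * (#(π.seeds φ) : ℝ) := by
  have := sum_gain_seedsFrom_le hM π C ∅ ∅ (by rwa [union_empty]) hS
    fun φ _ => activated_empty φ
  simp only [card_empty, Nat.cast_zero, sub_zero, union_empty] at this
  refine (le_of_eq (sum_congr rfl fun φ hφ => ?_)).trans this
  have hη : truncSpread η φ (S ∪ π.seedsFrom φ ∅) = η :=
    truncSpread_eq_of_le (hπ φ (hC.subset hφ)) subset_union_right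
  rw [hη]

end ResidualGain

/-! ### The greedy policy and its amortized cost. -/

section Greedy

variable {V : Type*} [Fintype V]

/-- The knowledge `K` can arise from observations: its seeds activate its active nodes in every
consistent realization, and consistency depends only on the edges leaving active nodes. -/
structure Knowledge.IsCoherent (G : Network V) (K : Knowledge V) : Prop where
  determined : IsDeterminedBy G K.consistent K.active
  activated_eq : ∀ φ ∈ K.consistent, activated φ K.seeds = K.active

lemma Knowledge.isCoherent_initial (G : Network V) : (Knowledge.initial G).IsCoherent G where
  determined := ⟨Subset.refl _, fun _ _ _ h _ => h⟩
  activated_eq φ _ := activated_empty φ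

variable [DecidableEq V]

lemma Knowledge.update_consistent (K : Knowledge V) (v : V) (A : Finset V) :
    (K.update v A).consistent = {φ ∈ K.consistent | activated φ (insert v K.seeds) = A} := by
  ext φ
  simp [Knowledge.update]

lemma Knowledge.IsCoherent.active_subset {G : Network V} {K : Knowledge V} (hK : K.IsCoherent G)
    {v : V} {A : Finset V} (hne : (K.update v A).consistent.Nonempty) : K.active ⊆ A := by
  obtain ⟨φ, hφ⟩ := hne
  rw [Knowledge.update_consistent] at hφ
  obtain ⟨h1, h2⟩ := mem_filter.1 hφ
  rw [← h2, ← hK.activated_eq φ h1]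
  exact activated_mono (Subset.refl _) (subset_insert v _)

lemma Knowledge.IsCoherent.update {G : Network V} {K : Knowledge V} (hK : K.IsCoherent G)
    {v : V} {A : Finset V} (hne : (K.update v A).consistent.Nonempty) :
    (K.update v A).IsCoherent G where
  determined := by
    rw [Knowledge.update_consistent]
    exact hK.determined.filter_activated (hK.active_subset hne) (Subset.refl _)
  activated_eq φ hφ := by
    rw [Knowledge.update_consistent] at hφ
    exact (mem_filter.1 hφ).2

lemma Knowledge.IsCoherent.marginal_eq {G : Network V} {K : Knowledge V} (hK : K.IsCoherent G)
    (η : ℕ) (hw : ∑ φ ∈ K.consistent, G.weight φ ≠ 0) (v : V) :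
    marginal G η K v = residualGain G η K.active v := by
  rw [marginal, hK.determined.sum_truncSpread_insert hK.activated_eq, mul_div_cancel_left₀ _ hw]

lemma Knowledge.mem_update_self {K : Knowledge V} {v : V} {φ : Realization V}
    (hφ : φ ∈ K.consistent) : φ ∈ (K.update v (activated φ (insert v K.seeds))).consistent := by
  rw [Knowledge.update_consistent]
  exact mem_filter.2 ⟨hφ, rfl⟩

lemma IsApproxGreedyFrom.le_spread {G : Network V} {η : ℕ} {α : ℝ} {π : Policy V} :
    ∀ {K : Knowledge V}, K.IsCoherent G → IsApproxGreedyFrom G η α π K →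
      ∀ φ ∈ K.consistent, η ≤ spread φ (π.seedsFrom φ K.seeds) := by
  induction π with
  | done =>
    intro K hK h φ hφ
    rw [Policy.seedsFrom, spread, hK.activated_eq φ hφ]
    exact h
  | select s next ih =>
    intro K hK h φ hφ
    have hmem := Knowledge.mem_update_self (v := s) hφ
    exact ih _ (hK.update ⟨φ, hmem⟩) (h.2.2.2 _ ⟨φ, hmem⟩) φ hmem

/-- Amortized cost bound for the greedy policy: `t` is a lower bound for the price of a unit of
spread, which only increases as the policy proceeds. -/
lemma IsApproxGreedyFrom.sum_cost_le {G : Network V} {η : ℕ} {α : ℝ} (hα : 0 < α)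
    {πopt : Policy V} (hopt : IsFeasible G η πopt) {π : Policy V} :
    ∀ {K : Knowledge V} {t : ℝ}, K.IsCoherent G → IsApproxGreedyFrom G η α π K → 0 < t → t ≤ 1 →
      (∀ v, t * residualGain G η K.active v ≤ 1) →
      α * ∑ φ ∈ K.consistent, G.weight φ * ((#(π.seedsFrom φ K.seeds) : ℝ) - (#K.seeds : ℝ)) ≤
        t * ∑ φ ∈ K.consistent, G.weight φ * ((η : ℝ) - (truncSpread η φ K.seeds : ℝ)) +
        -Real.log t * ∑ φ ∈ K.consistent, G.weight φ * (#(πopt.seeds φ) : ℝ) := by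
  induction π with
  | done =>
    intro K t hK h ht0 ht1 _
    have hshort : ∀ φ ∈ K.consistent, truncSpread η φ K.seeds = η := fun φ hφ =>
      truncSpread_eq_of_le (S := K.seeds) (by rw [spread, hK.activated_eq φ hφ]; exact h)
        (Subset.refl _)
    have h1 : ∑ φ ∈ K.consistent, G.weight φ * ((η : ℝ) - (truncSpread η φ K.seeds : ℝ)) = 0 :=
      sum_eq_zero fun φ hφ => by rw [hshort φ hφ, sub_self, mul_zero]
    simp only [Policy.seedsFrom, sub_self, mul_zero, sum_const_zero, h1, zero_add]
    exact mul_nonneg (neg_nonneg.2 (Real.log_nonpos ht0.le ht1))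
      (sum_nonneg fun φ _ => mul_nonneg (G.weight_nonneg φ) (Nat.cast_nonneg _))
  | select s next ih =>
    intro K t hK h ht0 ht1 htK
    obtain ⟨hlt, hs, hgreedy, hnext⟩ := h
    -- On a null event `marginal` is 0 by convention and the greedy condition says nothing, but all
    -- the sums vanish.
    rcases eq_or_ne (∑ φ ∈ K.consistent, G.weight φ) 0 with hw | hw
    · have hw' : ∀ φ ∈ K.consistent, G.weight φ = 0 :=
        (sum_eq_zero_iff_of_nonneg fun φ _ => G.weight_nonneg φ).1 hw
      have hz : ∀ f : Realization V → ℝ, ∑ φ ∈ K.consistent, G.weight φ * f φ = 0 := fun f =>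
        sum_eq_zero fun φ hφ => by rw [hw' φ hφ, zero_mul]
      simp [hz]
    obtain ⟨u, hu, hmax⟩ := exists_max_image (K.activeᶜ) (residualGain G η K.active)
      ⟨s, mem_compl.2 hs⟩
    set M := residualGain G η K.active u with hM
    have hM1 : 1 ≤ M := one_le_residualGain G hlt (mem_compl.1 hu)
    have hM0 : 0 < M := by linarith
    have hle : ∀ v, residualGain G η K.active v ≤ M := fun v => by
      by_cases hv : v ∈ K.active
      · rw [residualGain_of_mem G η hv]; exact hM0.le
      · exact hmax v (mem_compl.2 hv)
    have hMs : α * M ≤ residualGain G η K.active s := by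
      have := hgreedy u (mem_compl.1 hu)
      rwa [hK.marginal_eq η hw, hK.marginal_eq η hw] at this
    have hshort := sum_shortfall_le_of_isFeasible hle hK.determined hK.activated_eq hopt
    have hgain := hK.determined.sum_truncSpread_insert (η := η) hK.activated_eq s
    have hstep : α * ∑ φ ∈ K.consistent, G.weight φ * ((#(insert s K.seeds) : ℝ) - (#K.seeds : ℝ)) ≤
        M⁻¹ * ∑ φ ∈ K.consistent, G.weight φ *
          ((truncSpread η φ (insert s K.seeds) : ℝ) - (truncSpread η φ K.seeds : ℝ)) := by
      have hcard : (#(insert s K.seeds) : ℝ) - (#K.seeds : ℝ) ≤ 1 := by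
        rw [sub_le_iff_le_add, add_comm]
        exact_mod_cast card_insert_le s K.seeds
      have hw0 : 0 ≤ ∑ φ ∈ K.consistent, G.weight φ := sum_nonneg fun φ _ => G.weight_nonneg φ
      rw [hgain, ← sum_mul, inv_mul_eq_div, le_div_iff₀ hM0]
      calc α * ((∑ φ ∈ K.consistent, G.weight φ) * ((#(insert s K.seeds) : ℝ) - (#K.seeds : ℝ))) * M
          = (∑ φ ∈ K.consistent, G.weight φ) *
              (α * M * ((#(insert s K.seeds) : ℝ) - (#K.seeds : ℝ))) := by ring
        _ ≤ (∑ φ ∈ K.consistent, G.weight φ) * (α * M) :=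
            mul_le_mul_of_nonneg_left (mul_le_of_le_one_right (by positivity) hcard) hw0
        _ ≤ _ := mul_le_mul_of_nonneg_left hMs hw0
    have hrest : α * ∑ φ ∈ K.consistent, G.weight φ *
          ((#((Policy.select s next).seedsFrom φ K.seeds) : ℝ) - (#(insert s K.seeds) : ℝ)) ≤
        M⁻¹ * ∑ φ ∈ K.consistent, G.weight φ *
            ((η : ℝ) - (truncSpread η φ (insert s K.seeds) : ℝ)) +
          Real.log M * ∑ φ ∈ K.consistent, G.weight φ * (#(πopt.seeds φ) : ℝ) := by
      simp only [← sum_fiberwise K.consistent (fun φ => activated φ (insert s K.seeds))]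
      rw [mul_sum, mul_sum, mul_sum, ← sum_add_distrib]
      refine sum_le_sum fun A _ => ?_
      rw [← Knowledge.update_consistent]
      rcases (K.update s A).consistent.eq_empty_or_nonempty with h0 | hne
      · simp [h0]
      -- The price is raised to `M⁻¹`; it stays admissible because residual gains never increase.
      · have key := ih A (t := M⁻¹) (hK.update hne) (hnext A hne) (inv_pos.2 hM0)
          (inv_le_one_of_one_le₀ hM1) fun v => by
            rw [inv_mul_le_one₀ hM0]
            exact (residualGain_anti G η (hK.active_subset hne) v).trans (hle v)
        rw [Real.log_inv, neg_neg] at key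
        refine (le_of_eq (congrArg (α * ·) (sum_congr rfl fun φ hφ => ?_))).trans key
        have : activated φ (insert s K.seeds) = A := (hK.update hne).activated_eq φ hφ
        rw [Policy.seedsFrom, this]
        rfl
    have e1 := G.sum_weight_mul_sub_eq_add K.consistent (fun φ => (#((Policy.select s next).seedsFrom φ K.seeds) : ℝ))
      (fun _ => (#(insert s K.seeds) : ℝ)) (fun _ => (#K.seeds : ℝ))
    have e2 := G.sum_weight_mul_sub_eq_add K.consistent (fun _ => (η : ℝ)) (fun φ => (truncSpread η φ (insert s K.seeds) : ℝ))
      (fun φ => (truncSpread η φ K.seeds : ℝ))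
    beta_reduce at e1 e2
    have hW : 0 ≤ ∑ φ ∈ K.consistent, G.weight φ * (#(πopt.seeds φ) : ℝ) :=
      sum_nonneg fun φ _ => mul_nonneg (G.weight_nonneg φ) (Nat.cast_nonneg _)
    set W := ∑ φ ∈ K.consistent, G.weight φ * (#(πopt.seeds φ) : ℝ)
    set R := ∑ φ ∈ K.consistent, G.weight φ * ((η : ℝ) - (truncSpread η φ K.seeds : ℝ))
    have htM : t ≤ M⁻¹ := by
      rw [← one_div, le_div_iff₀ hM0]
      exact htK u
    -- Raising the price from `t` to `M⁻¹` adds `(M⁻¹ - t) * R`. Since `R ≤ M * W`, the growth of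
    -- the logarithmic term pays for it, by `1 - x ≤ -log x` at `x = t * M`.
    have hprice : (M⁻¹ - t) * R ≤ (1 - t * M) * W := by
      calc (M⁻¹ - t) * R ≤ (M⁻¹ - t) * (M * W) :=
            mul_le_mul_of_nonneg_left hshort (sub_nonneg.2 htM)
        _ = (1 - t * M) * W := by field_simp
    have hlog : 1 - t * M ≤ -Real.log t - Real.log M := by
      have := Real.log_le_sub_one_of_pos (mul_pos ht0 hM0)
      rw [Real.log_mul ht0.ne' hM0.ne'] at this
      linarith
    have hlogW := mul_le_mul_of_nonneg_right hlog hW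
    rw [e1, mul_add]
    have e3 := congrArg (M⁻¹ * ·) e2
    simp only [mul_add] at e3
    linarith

end Greedy

end ASM

/-! ### The approximation guarantee. -/

theorem theorem1 {V : Type*} [Fintype V] [DecidableEq V] (G : ASM.Network V)
    (η : ℕ) (hη : 1 ≤ η) (hηn : η ≤ Fintype.card V)
    (α : ℝ) (hα : 0 < α) (hα1 : α ≤ 1)
    (π : ASM.Policy V) (hπ : ASM.IsApproxGreedy G η α π) :
    ASM.IsFeasible G η π ∧
      ∀ πopt : ASM.Policy V, ASM.IsFeasible G η πopt →
        ASM.expectedCost G π ≤ (Real.log (η : ℝ) + 1) ^ 2 / α * ASM.expectedCost G πopt := by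
  have hK := ASM.Knowledge.isCoherent_initial G
  refine ⟨fun φ hφ => ASM.IsApproxGreedyFrom.le_spread hK hπ φ hφ, fun πopt hopt => ?_⟩
  have hη1 : (1 : ℝ) ≤ η := by exact_mod_cast hη
  have hη0 : (0 : ℝ) < η := by linarith
  -- The starting price is `1/η`, as no gain exceeds `η`; the initial shortfall `η` then contributes
  -- exactly 1.
  have hbound := ASM.IsApproxGreedyFrom.sum_cost_le hα hopt hK hπ (inv_pos.2 hη0)
    (inv_le_one_of_one_le₀ hη1) fun v => by
      rw [inv_mul_le_one₀ hη0]
      exact ASM.residualGain_le G η _ v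
  have hshort : ∑ φ ∈ G.realizations, G.weight φ * ((η : ℝ) - (ASM.truncSpread η φ ∅ : ℝ)) = η := by
    simp [ASM.truncSpread, ASM.spread, ASM.activated_empty, ← Finset.sum_mul, G.sum_weight]
  have hone : 1 ≤ ASM.expectedCost G πopt := by
    rw [← G.sum_weight]
    refine Finset.sum_le_sum fun φ hφ => le_mul_of_one_le_right (G.weight_nonneg φ) ?_
    have hne : (πopt.seeds φ).Nonempty := by
      rw [Finset.nonempty_iff_ne_empty]
      intro h0
      have := hopt φ hφ
      rw [h0, ASM.spread, ASM.activated_empty, Finset.card_empty] at this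
      omega
    exact_mod_cast hne.card_pos
  have hcost : α * ASM.expectedCost G π ≤ 1 + Real.log η * ASM.expectedCost G πopt := by
    simpa [ASM.Knowledge.initial, hshort, hη0.ne', ASM.expectedCost, ASM.Policy.seeds] using hbound
  have hlog : 0 ≤ Real.log η := Real.log_nonneg hη1
  rw [div_mul_eq_mul_div, le_div_iff₀ hα]
  -- With L = ln η and c the cost of `πopt`, the slack is L(L+1)c + (c − 1).
  nlinarith [mul_nonneg hlog (mul_nonneg (add_nonneg hlog zero_le_one)
    (zero_le_one.trans hone))]
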